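/- Let $A$ be a (not necessarily unital) real C*-algebra, i.e. a real Banach $*$-algebra that is isometrically $*$-isomorphic to a norm-closed $*$-algebra of bounded operators on a real Hilbert space. Call $A$ \emph{simple} if $A\neq 0$ and its only closed two-sided ideals are $0$ and $A$, and call $A$ \emph{purely infinite} if for every nonzero positive $x\in A$ (that is, $x=y^*y$ for some $y\in A$) the hereditary subalgebra $\overline{xAx}$ contains an infinite projection, that is, a projection $p$ for which there is $v\in A$ with $v^*v=p$ and $vv^*$ a projection, $vv^*\le p$, $vv^*\neq p$. Suppose that $A$ is simple and purely infinite, and let $H$ be any nonzero real Hilbert space (for example the separable infinite-dimensional one, in which case $\mathcal{K}(H)\otimes_{\mathbb R}A$ is the stabilization of $A$). Let $\mathcal{K}(H)\otimes_{\mathbb R}A$ be the C*-tensor product over $\mathbb{R}$ of the algebra $\mathcal{K}(H)$ of compact operators with $A$: for any isometric $*$-representation $\pi$ of $A$ on a real Hilbert space $E$, it is the norm-closed $*$-algebra of operators on the Hilbert space tensor product $H\otimes E$ generated by the operators $k\otimes\pi(a)$ with $k\in\mathcal{K}(H)$ and $a\in A$. Then $\mathcal{K}(H)\otimes_{\mathbb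 R}A$ is again purely infinite and simple. -/

import Mathlib

open scoped TensorProduct

universe u v w

/-- A real C*-algebra (not assumed unital): a real Banach *-algebra that is isometrically
*-isomorphic to a (necessarily norm-closed) *-algebra of bounded operators on some real Hilbert
space. -/
class RealCStarAlgebra (A : Type u) extends NonUnitalNormedRing A, StarRing A, NormedSpace ℝ A,
    IsScalarTower ℝ A A, SMulCommClass ℝ A A, StarModule ℝ A, CompleteSpace A where
  exists_isometric_rep : ∃ (E : Type u) (_ : NormedAddCommGroup E) (_ : InnerProductSpace ℝ E)
    (_ : CompleteSpace E) (π : A →⋆ₙₐ[ℝ] (E →L[ℝ] E)), Isometry π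

/-- A norm-closed *-subalgebra of the bounded operators on a real Hilbert space is a real
C*-algebra. -/
noncomputable instance NonUnitalStarSubalgebra.realCStarAlgebra {E : Type u}
    [NormedAddCommGroup E] [InnerProductSpace ℝ E] [CompleteSpace E]
    (B : NonUnitalStarSubalgebra ℝ (E →L[ℝ] E)) [hB : IsClosed (B : Set (E →L[ℝ] E))] :
    RealCStarAlgebra B where
  toCompleteSpace := hB.completeSpace_coe
  exists_isometric_rep :=
    ⟨E, inferInstance, inferInstance, inferInstance,
      NonUnitalStarSubalgebraClass.subtype B, fun _ _ => rfl⟩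

namespace RealCStarAlgebra

section Predicates

variable {A : Type u} [RealCStarAlgebra A]

/-- A real C*-algebra is simple if it is nonzero and its only closed two-sided ideals are `0` and
the whole algebra. -/
def Simple (A : Type u) [RealCStarAlgebra A] : Prop :=
  Nontrivial A ∧ ∀ I : Submodule ℝ A, IsClosed (I : Set A) →
    (∀ a : A, ∀ x ∈ I, a * x ∈ I ∧ x * a ∈ I) → I = ⊥ ∨ I = ⊤

/-- Positive elements of a real C*-algebra: those of the form `y* y`. -/
def Positive (x : A) : Prop := ∃ y : A, x = star y * y

/-- The hereditary subalgebra generated by a positive element `x`: the closure of `x A x`. -/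
def hereditary (x : A) : Set A := closure (Set.range fun a : A => x * a * x)

/-- An infinite projection: a projection `p` that is Murray-von Neumann equivalent to a proper
subprojection `v v* < p = v* v` of itself. -/
def InfiniteProjection (p : A) : Prop :=
  IsStarProjection p ∧
    ∃ v : A, star v * v = p ∧ IsStarProjection (v * star v) ∧
      p * (v * star v) = v * star v ∧ v * star v ≠ p

/-- A real C*-algebra is purely infinite if, for every nonzero positive element `x`, the hereditary
subalgebra `closure (x A x)` contains an infinite projection. -/
def PurelyInfinite (A : Type u) [RealCStarAlgebra A] : Prop :=
  ∀ x : A, Positive x → x ≠ 0 → ∃ p ∈ hereditary x, InfiniteProjection p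

end Predicates

end RealCStarAlgebra

section HilbertTensor

/-- The Hilbert space tensor product of two real Hilbert spaces: the completion of the algebraic
tensor product for the inner product `⟪ξ ⊗ η, ξ' ⊗ η'⟫ = ⟪ξ, ξ'⟫ ⟪η, η'⟫`. -/
def HilbertTensor (H : Type v) (E : Type w) [NormedAddCommGroup H] [InnerProductSpace ℝ H]
    [NormedAddCommGroup E] [InnerProductSpace ℝ E] : Type (max v w) :=
  UniformSpace.Completion (H ⊗[ℝ] E)

namespace HilbertTensor

variable {H : Type v} {E : Type w} [NormedAddCommGroup H] [InnerProductSpace ℝ H]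
  [NormedAddCommGroup E] [InnerProductSpace ℝ E]

noncomputable instance : NormedAddCommGroup (HilbertTensor H E) :=
  inferInstanceAs (NormedAddCommGroup (UniformSpace.Completion (H ⊗[ℝ] E)))

noncomputable instance : InnerProductSpace ℝ (HilbertTensor H E) :=
  inferInstanceAs (InnerProductSpace ℝ (UniformSpace.Completion (H ⊗[ℝ] E)))

instance : CompleteSpace (HilbertTensor H E) :=
  inferInstanceAs (CompleteSpace (UniformSpace.Completion (H ⊗[ℝ] E)))

/-- The canonical isometric embedding of the algebraic tensor product. -/
noncomputable def ofTensor : H ⊗[ℝ] E →ₗᵢ[ℝ] HilbertTensor H E :=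
  (UniformSpace.Completion.toComplₗᵢ :
    H ⊗[ℝ] E →ₗᵢ[ℝ] UniformSpace.Completion (H ⊗[ℝ] E))

theorem denseRange_ofTensor : DenseRange (ofTensor : H ⊗[ℝ] E → HilbertTensor H E) :=
  UniformSpace.Completion.denseRange_coe

/-- The bounded operator `k ⊗ T` on the Hilbert space tensor product. -/
noncomputable def tensorOp (k : H →L[ℝ] H) (T : E →L[ℝ] E) :
    HilbertTensor H E →L[ℝ] HilbertTensor H E :=
  ((TensorProduct.mapL k T).completion :
    UniformSpace.Completion (H ⊗[ℝ] E) →L[ℝ] UniformSpace.Completion (H ⊗[ℝ] E))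

theorem tensorOp_tmul (k : H →L[ℝ] H) (T : E →L[ℝ] E) (ξ : H) (η : E) :
    tensorOp k T (ofTensor (ξ ⊗ₜ[ℝ] η)) = ofTensor (k ξ ⊗ₜ[ℝ] T η) :=
  ContinuousLinearMap.completion_apply_coe (TensorProduct.mapL k T) (ξ ⊗ₜ[ℝ] η)

end HilbertTensor

end HilbertTensor

namespace RealCStarAlgebra

section CompactTensor

variable (H : Type v) [NormedAddCommGroup H] [InnerProductSpace ℝ H]
  {E : Type w} [NormedAddCommGroup E] [InnerProductSpace ℝ E] [CompleteSpace E]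
  {A : Type u} [RealCStarAlgebra A]

/-- The spatial tensor product over `ℝ` of the algebra of compact operators on the real Hilbert
space `H` with the real C*-algebra `A`, where `A` is represented on the real Hilbert space `E`
by `π`: the norm-closed *-algebra of operators on the Hilbert space tensor product of `H` and `E`
generated by the operators `k ⊗ π a`, with `k` compact and `a` in `A`. -/
noncomputable def compactTensor (π : A →⋆ₙₐ[ℝ] (E →L[ℝ] E)) :
    NonUnitalStarSubalgebra ℝ (HilbertTensor H E →L[ℝ] HilbertTensor H E) :=
  (NonUnitalStarAlgebra.adjoin ℝ
    {S | ∃ (k : H →L[ℝ] H) (a : A), IsCompactOperator k ∧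
      S = HilbertTensor.tensorOp k (π a)}).topologicalClosure

instance isClosed_compactTensor (π : A →⋆ₙₐ[ℝ] (E →L[ℝ] E)) :
    IsClosed (compactTensor H π : Set (HilbertTensor H E →L[ℝ] HilbertTensor H E)) :=
  NonUnitalStarSubalgebra.isClosed_topologicalClosure _

end CompactTensor

end RealCStarAlgebra

/-! For rank one `θ = ⟨β, ·⟩ α`, the operator `θ ⊗ π a` is `creation α ∘L π a ∘L adjoint (creation
β)`. Such operators multiply like matrix units with entries in `A`, and they span a dense subspace
of `K(H) ⊗ A` because compact operators are limits of finite rank ones. Hence each slice `adjoint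
(creation ζ) ∘L S ∘L creation ξ` of an element `S` lies in `π(A)`, and a nonzero `S` has a nonzero
slice `s` at unit vectors. Multiplying `S` by rank one tensors on both sides produces `a s b` in any
matrix position (`exists_slice_mul`).

Simplicity: the entries that a nonzero closed ideal contains in every position form a closed ideal
of `A`, which contains `s* s s* ≠ 0` and so is `A`.

Pure infiniteness: an infinite projection of `A` in the hereditary subalgebra of `s* s` lies within
distance `1` of some `s* s b s* s`. So an infinite projection `P` of `K(H) ⊗ A` lies within distance
`1` of some `z x t`. Then `X = x t P` is bounded below on the range of `P`, and its polar part `U`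
satisfies `U* U = P` and `U U* ∈ x B x`, where `B = K(H) ⊗ A`; so `U U*` is again infinite. The
inverse square root needed for `U` comes from two contraction arguments, without functional
calculus. -/

/-- A map contracting on a nonempty closed subset of a Banach space has a fixed point there. -/
theorem exists_fixedPoint_of_norm_sub_le {X : Type*} [NormedAddCommGroup X] [CompleteSpace X]
    {s : Set X} (hs : IsClosed s) {x₀ : X} (hx₀ : x₀ ∈ s) {f : X → X} (hf : Set.MapsTo f s s)
    {δ : ℝ} (hδ0 : 0 ≤ δ) (hδ : δ < 1) (h : ∀ x ∈ s, ∀ y ∈ s, ‖f x - f y‖ ≤ δ * ‖x - y‖) :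
    ∃ x ∈ s, f x = x := by
  lift δ to NNReal using hδ0
  have hc : ContractingWith δ (hf.restrict f s s) :=
    ⟨by exact_mod_cast hδ, LipschitzWith.of_dist_le_mul fun x y => by
      simpa [Subtype.dist_eq, dist_eq_norm] using h x x.2 y y.2⟩
  obtain ⟨x, hx, hfx, -⟩ := hc.exists_fixedPoint' hs.isComplete hf hx₀ (edist_ne_top _ _)
  exact ⟨x, hx, hfx⟩

/-! ### Polar decomposition in corners and comparison of infinite projections. -/

namespace RealCStarAlgebra

variable {B : Type u} [RealCStarAlgebra B]

theorem norm_star_mul_self (x : B) : ‖star x * x‖ = ‖x‖ * ‖x‖ := by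
  obtain ⟨E, _, _, _, π, hπ⟩ := exists_isometric_rep (A := B)
  have hn : ∀ a : B, ‖a‖ = ‖π a‖ := fun a => ((AddMonoidHomClass.isometry_iff_norm π).1 hπ a).symm
  rw [hn, hn x, map_mul, map_star]
  exact ContinuousLinearMap.norm_adjoint_comp_self (π x)

instance : CStarRing B where
  norm_mul_self_le x := (norm_star_mul_self x).ge

/-- The inverse square root of `p - w` in the corner of the projection `p`. -/
theorem exists_inv_sqrt {p w : B} (hp : IsStarProjection p) (hw : star w = w) (hpw : p * w = w)
    (hw1 : ‖w‖ < 1) : ∃ u : B, star u = u ∧ p * u = u ∧ u * (p - w) * u = p := by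
  have hpp : p * p = p := hp.isIdempotentElem
  have hps : star p = p := hp.isSelfAdjoint
  have hwp : w * p = w := by
    have := congrArg star hpw
    rwa [star_mul, hps, hw] at this
  set δ := ‖w‖
  have hδ : 0 ≤ δ := norm_nonneg w
  -- The equation `y = (w + y²)/2` says `(p - y)² = p - w`. The ball of radius `δ` is preserved
  -- since `(δ + δ²)/2 ≤ δ`, and `x² - y² = x(x - y) + (x - y)y` gives the Lipschitz constant `δ`.
  obtain ⟨y, ⟨hy, hyp, hyn⟩, hfy⟩ : ∃ y ∈ {y : B | star y = y ∧ p * y = y ∧ ‖y‖ ≤ δ},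
      (1 / 2 : ℝ) • (w + y * y) = y := by
    refine exists_fixedPoint_of_norm_sub_le (δ := δ) (x₀ := 0) ?_ (by simp [hδ]) ?_ hδ hw1 ?_
    · exact (isClosed_eq continuous_star continuous_id).inter
        ((isClosed_eq (continuous_const.mul continuous_id) continuous_id).inter
          (isClosed_le continuous_norm continuous_const))
    · rintro y ⟨h1, h2, h3⟩
      refine ⟨by simp [star_smul, hw, h1], by
        rw [mul_smul_comm, mul_add, hpw, ← mul_assoc, h2], ?_⟩
      rw [norm_smul]
      have h4 : ‖w + y * y‖ ≤ δ + ‖y‖ * ‖y‖ :=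
        (norm_add_le _ _).trans (add_le_add le_rfl (norm_mul_le _ _))
      norm_num
      nlinarith [norm_nonneg y]
    · rintro x ⟨-, -, hx⟩ y ⟨-, -, hy⟩
      have h1 : (1 / 2 : ℝ) • (w + x * x) - (1 / 2 : ℝ) • (w + y * y) =
          (1 / 2 : ℝ) • (x * (x - y) + (x - y) * y) := by
        rw [← smul_sub, mul_sub, sub_mul]; congr 1; abel
      rw [h1, norm_smul]
      have h2 : ‖x * (x - y) + (x - y) * y‖ ≤ ‖x‖ * ‖x - y‖ + ‖x - y‖ * ‖y‖ :=
        (norm_add_le _ _).trans (add_le_add (norm_mul_le _ _) (norm_mul_le _ _))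
      norm_num
      nlinarith [norm_nonneg (x - y), mul_le_mul_of_nonneg_right hx (norm_nonneg (x - y)),
        mul_le_mul_of_nonneg_left hy (norm_nonneg (x - y))]
  have hyp' : y * p = y := by
    have := congrArg star hyp
    rwa [star_mul, hps, hy] at this
  have hk : (p - y) * (p - y) = p - w := by
    have : w = y + y - y * y := by
      rw [eq_sub_iff_add_eq, ← two_smul ℝ y]
      nth_rewrite 3 [← hfy]
      rw [smul_smul]; norm_num
    rw [sub_mul, mul_sub, mul_sub, hpp, hyp, hyp', this]; abel
  -- `u = p + y u` means `(p - y) u = p`: a right inverse of the square root in the corner of `p`.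
  obtain ⟨u, hup, hfu⟩ : ∃ u ∈ {u : B | p * u = u}, p + y * u = u := by
    refine exists_fixedPoint_of_norm_sub_le (δ := δ) (x₀ := 0) ?_ (by simp) ?_ hδ hw1 ?_
    · exact isClosed_eq (continuous_const.mul continuous_id) continuous_id
    · rintro u hu
      change p * (p + y * u) = p + y * u
      rw [mul_add, hpp, ← mul_assoc, hyp]
    · rintro a - b -
      have : p + y * a - (p + y * b) = y * (a - b) := by rw [mul_sub]; abel
      rw [this]
      exact (norm_mul_le _ _).trans (mul_le_mul_of_nonneg_right hyn (norm_nonneg _))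
  have hku : (p - y) * u = p := by
    rw [sub_mul, hup, sub_eq_iff_eq_add, hfu]
  have huk : star u * (p - y) = p := by
    have := congrArg star hku
    rwa [star_mul, star_sub, hps, hy] at this
  have husp : star u * p = star u := by
    have := congrArg star hup
    rwa [star_mul, hps] at this
  -- The left inverse `star u` and the right inverse `u` of `p - y` coincide.
  have hus : star u = u := by
    rw [← husp, ← hku, ← mul_assoc, huk, hup]
  rw [hus] at huk
  exact ⟨u, hus, hup, by rw [← hk, ← mul_assoc, huk, mul_assoc, hku, hpp]⟩

/-- If `X` is bounded below on the range of a projection `p`, in the form that `z X` is close to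
`p`, then `X` can be corrected in the corner of `p` to a partial isometry with initial
projection `p`. -/
theorem exists_partialIsometry {p X z : B} (hp : IsStarProjection p) (hXp : X * p = X)
    (hz : ‖z * X - p‖ < 1) :
    ∃ c : B, p * c = c ∧ c * p = c ∧ star (X * c) * (X * c) = p := by
  have hpp : p * p = p := hp.isIdempotentElem
  have hps : star p = p := hp.isSelfAdjoint
  by_cases hp0 : p = 0
  · exact ⟨0, by simp, by simp, by simp [hp0]⟩
  have hpX : p * star X = star X := by
    have := congrArg star hXp
    rwa [star_mul, hps] at this
  have hX0 : X ≠ 0 := by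
    rintro rfl
    have h1 : ‖p‖ * ‖p‖ = ‖p‖ := by rw [← norm_star_mul_self, hps, hpp]
    have h2 : 0 < ‖p‖ := norm_pos_iff.2 hp0
    have h3 : ‖p‖ < 1 := by simpa using hz
    nlinarith
  set C : ℝ := ‖X‖ * ‖X‖ with hC
  have hC0 : 0 < C := mul_pos (norm_pos_iff.2 hX0) (norm_pos_iff.2 hX0)
  -- Scaling by `C = ‖X‖²` turns `X* X` into `p - W`. The bound `‖W‖ < 1` is checked on vectors of a
  -- Hilbert space representation.
  set W : B := p - C⁻¹ • (star X * X) with hW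
  have hWs : star W = W := by simp [hW, star_smul, hps]
  have hpW : p * W = W := by rw [hW, mul_sub, hpp, mul_smul_comm, ← mul_assoc, hpX]
  have hWp : W * p = W := by
    have := congrArg star hpW
    rwa [star_mul, hps, hWs] at this
  have hW1 : ‖W‖ < 1 := by
    obtain ⟨E, _, _, _, π, hπ⟩ := exists_isometric_rep (A := B)
    have hn : ∀ a : B, ‖π a‖ = ‖a‖ := (AddMonoidHomClass.isometry_iff_norm π).1 hπ
    have hadj : ∀ (a : B) (e f : E), inner ℝ (π (star a) e) f = inner ℝ e (π a f) := by
      intro a e f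
      rw [map_star, ContinuousLinearMap.star_eq_adjoint, ContinuousLinearMap.adjoint_inner_left]
    have hmul : ∀ (a b : B) (e : E), π a (π b e) = π (a * b) e := fun a b e => by
      rw [map_mul]; rfl
    have hbd : ∀ (a : B) (e : E), ‖π a e‖ ≤ ‖a‖ * ‖e‖ := fun a e => by
      rw [← hn]; exact (π a).le_opNorm e
    set ε := ‖z * X - p‖
    have hε0 : 0 ≤ ε := norm_nonneg _
    have hzp : 0 < ‖z‖ := by
      rw [norm_pos_iff]
      rintro rfl
      have h1 : ‖p‖ * ‖p‖ = ‖p‖ := by rw [← norm_star_mul_self, hps, hpp]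
      have h2 : 0 < ‖p‖ := norm_pos_iff.2 hp0
      have h3 : ‖p‖ < 1 := by simpa [ε] using hz
      nlinarith
    set m := (1 - ε) / ‖z‖ with hm
    have hm0 : 0 < m := div_pos (by linarith) hzp
    have hlow : ∀ e : E, m * ‖π p e‖ ≤ ‖π X e‖ := by
      intro e
      have h1 : ‖π (z * X - p) (π p e)‖ ≤ ε * ‖π p e‖ := hbd _ _
      have h2 : π (z * X - p) (π p e) = π z (π X e) - π p e := by
        rw [hmul, hmul, sub_mul, mul_assoc, hXp, hpp, map_sub]; rfl
      have h3 : ‖π z (π X e)‖ ≤ ‖z‖ * ‖π X e‖ := hbd _ _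
      have h4 : ‖π p e‖ ≤ ‖π z (π X e)‖ + ‖π z (π X e) - π p e‖ := by
        have := norm_sub_le (π z (π X e)) (π z (π X e) - π p e)
        rwa [sub_sub_cancel] at this
      rw [h2] at h1
      rw [hm, div_mul_eq_mul_div, div_le_iff₀ hzp]
      linarith
    have hple : ∀ e : E, ‖π p e‖ ≤ ‖e‖ := by
      intro e
      have h1 : ‖π p e‖ * ‖π p e‖ ≤ ‖π p e‖ * ‖e‖ := by
        have h2 : inner ℝ (π p e) (π p e) = inner ℝ (π p e) e := by
          conv_rhs => rw [← hpp, ← hmul, ← hps, hadj]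
          rw [hps]
        rw [← real_inner_self_eq_norm_mul_norm, h2]
        exact real_inner_le_norm _ _
      rcases (norm_nonneg (π p e)).eq_or_lt with h | h
      · rw [← h]; positivity
      · exact le_of_mul_le_mul_left h1 h
    -- Makes `1 - m²/C` nonnegative, so that the square root in the next bound is a genuine one.
    have hmC : m * m ≤ C := by
      obtain ⟨e, he⟩ : ∃ e, π p e ≠ 0 := by
        by_contra! h
        apply hp0
        rw [← norm_eq_zero, ← hn, norm_eq_zero]
        ext e; exact h e
      have h1 : m * ‖π p e‖ ≤ ‖X‖ * ‖π p e‖ := by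
        have := hbd X (π p e)
        rw [hmul, hXp] at this
        exact (hlow e).trans this
      have h2 : m ≤ ‖X‖ := le_of_mul_le_mul_right h1 (norm_pos_iff.2 he)
      exact mul_le_mul h2 h2 hm0.le (norm_nonneg _)
    -- Expand `‖W e‖² = ‖p e‖² - 2C⁻¹‖X e‖² + C⁻²‖X* X e‖²`. The last term is at most `C⁻¹‖X e‖²`,
    -- and `‖X e‖ ≥ m‖p e‖`.
    have hkey : ∀ e : E, ‖π W e‖ ≤ √(1 - m * m / C) * ‖e‖ := by
      intro e
      have h0 : 0 ≤ 1 - m * m / C := by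
        rw [sub_nonneg, div_le_one hC0]; exact hmC
      have hWe : π W e = π p e - C⁻¹ • π (star X * X) e := by
        rw [hW, map_sub, map_smul]; rfl
      have h1 : inner ℝ (π p e) (π (star X * X) e) = ‖π X e‖ ^ 2 := by
        rw [← hadj, hmul, star_mul, star_star, mul_assoc, hXp, ← hmul, hadj,
          real_inner_self_eq_norm_sq]
      have h2 : ‖π (star X * X) e‖ ^ 2 ≤ C * ‖π X e‖ ^ 2 := by
        have := hbd (star X) (π X e)
        rw [hmul, norm_star] at this
        calc ‖π (star X * X) e‖ ^ 2 ≤ (‖X‖ * ‖π X e‖) ^ 2 := by gcongr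
          _ = C * ‖π X e‖ ^ 2 := by rw [hC]; ring
      have h3 : ‖π W e‖ ^ 2 ≤ (1 - m * m / C) * ‖e‖ ^ 2 := by
        have h4 : (m * ‖π p e‖) ^ 2 ≤ ‖π X e‖ ^ 2 := by
          gcongr; exact hlow e
        have h5 : ‖π p e‖ ^ 2 ≤ ‖e‖ ^ 2 := by gcongr; exact hple e
        rw [hWe, norm_sub_sq_real, inner_smul_right, h1, norm_smul, mul_pow, Real.norm_eq_abs,
          sq_abs]
        have h6 : C⁻¹ ^ 2 * ‖π (star X * X) e‖ ^ 2 ≤ C⁻¹ * ‖π X e‖ ^ 2 := by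
          calc C⁻¹ ^ 2 * ‖π (star X * X) e‖ ^ 2 ≤ C⁻¹ ^ 2 * (C * ‖π X e‖ ^ 2) := by gcongr
            _ = C⁻¹ * ‖π X e‖ ^ 2 := by field_simp
        have h7 : C⁻¹ * (m * ‖π p e‖) ^ 2 ≤ C⁻¹ * ‖π X e‖ ^ 2 := by gcongr
        have h8 : C⁻¹ * (m * ‖π p e‖) ^ 2 = m * m / C * ‖π p e‖ ^ 2 := by
          field_simp
        have h9 := mul_le_mul_of_nonneg_left h5 h0
        linarith
      calc ‖π W e‖ = √(‖π W e‖ ^ 2) := (Real.sqrt_sq (norm_nonneg _)).symm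
        _ ≤ √((1 - m * m / C) * ‖e‖ ^ 2) := Real.sqrt_le_sqrt h3
        _ = √(1 - m * m / C) * ‖e‖ := by
          rw [Real.sqrt_mul h0, Real.sqrt_sq (norm_nonneg _)]
    rw [← hn]
    refine ((π W).opNorm_le_bound (Real.sqrt_nonneg _) hkey).trans_lt ?_
    rw [Real.sqrt_lt' one_pos, one_pow]
    have : 0 < m * m / C := div_pos (mul_pos hm0 hm0) hC0
    linarith
  obtain ⟨c, hcs, hpc, hc⟩ := exists_inv_sqrt hp hWs hpW hW1
  have hcp : c * p = c := by
    have := congrArg star hpc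
    rwa [star_mul, hps, hcs] at this
  refine ⟨(√C)⁻¹ • c, by rw [mul_smul_comm, hpc], by rw [smul_mul_assoc, hcp], ?_⟩
  have h1 : p - W = C⁻¹ • (star X * X) := by rw [hW, sub_sub_cancel]
  rw [h1, mul_smul_comm, smul_mul_assoc] at hc
  have h2 : (√C)⁻¹ * (√C)⁻¹ = C⁻¹ := by rw [← mul_inv, Real.mul_self_sqrt hC0.le]
  rw [mul_smul_comm, star_smul, star_mul, hcs, smul_mul_smul_comm, star_trivial, h2, ← hc]
  simp only [mul_assoc]

/-- By the C*-identity it suffices that `(p v - v)(p v - v)*` vanishes. -/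
theorem InfiniteProjection.corner {p v : B} (hp : IsStarProjection p)
    (hle : p * (v * star v) = v * star v) : p * v = v := by
  have hps : star p = p := hp.isSelfAdjoint
  have hpp : p * p = p := hp.isIdempotentElem
  have h' : v * star v * p = v * star v := by
    have := congrArg star hle
    simpa [star_mul, hps, mul_assoc] using this
  have h : (p * v - v) * star (p * v - v) = 0 := by
    rw [star_sub, star_mul, hps, sub_mul, mul_sub, mul_sub]
    rw [← mul_assoc (p * v), mul_assoc p v, hle, h', ← mul_assoc v, h']
    simp
  exact sub_eq_zero.1 (CStarRing.mul_star_self_eq_zero_iff _ |>.1 h)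

/-- Infinite projections are transported by partial isometries. -/
theorem InfiniteProjection.mul_star {p U : B} (hp : InfiniteProjection p)
    (hU : star U * U = p) (hUp : U * p = U) : InfiniteProjection (U * star U) := by
  obtain ⟨hproj, v, hv, hvv, hle, hne⟩ := hp
  have hpp : p * p = p := hproj.isIdempotentElem
  have hps : star p = p := hproj.isSelfAdjoint
  have hpv : p * v = v := corner hproj hle
  have hvp : v * p = v := by
    have h : star (v * p - v) * (v * p - v) = 0 := by
      rw [star_sub, star_mul, hps, sub_mul, mul_sub, mul_sub, ← mul_assoc (p * star v),
        mul_assoc p, mul_assoc p, ← mul_assoc (star v), hv, hpp, hpp]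
      simp
    exact sub_eq_zero.1 ((CStarRing.star_mul_self_eq_zero_iff _).1 h)
  have hmul : ∀ a b : B, U * a * star U * (U * b * star U) = U * (a * (p * b)) * star U := by
    intro a b
    rw [← hU]; simp only [mul_assoc]
  have hstar : ∀ a : B, star (U * a * star U) = U * star a * star U := by
    intro a
    simp only [star_mul, star_star, mul_assoc]
  have hprojU : ∀ q : B, IsStarProjection q → p * q = q → IsStarProjection (U * q * star U) := by
    intro q hq hpq
    refine ⟨?_, ?_⟩
    · have hqq : q * q = q := hq.isIdempotentElem
      change U * q * star U * (U * q * star U) = U * q * star U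
      rw [hmul, hpq, hqq]
    · have hqs : star q = q := hq.isSelfAdjoint
      change star _ = _
      rw [hstar, hqs]
  have hUU : U * star U = U * p * star U := by rw [hUp]
  have hvU : U * v * star U * star (U * v * star U) = U * (v * star v) * star U := by
    rw [hstar, hmul, ← mul_assoc v, hvp]
  -- Conjugation by `U` is multiplicative on the corner of `p`, so `U v U*` witnesses infiniteness.
  refine ⟨?_, U * v * star U, ?_, ?_, ?_, ?_⟩
  · rw [hUU]; exact hprojU p hproj hpp
  · rw [hstar, hmul, hpv, hv, hUU]
  · rw [hvU]; exact hprojU _ hvv hle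
  · rw [hvU, hUU, hmul, hle, hle]
  · rw [hvU, hUU]
    intro h
    apply hne
    -- Compressing by `U* · U` undoes the conjugation and would give `v v* = p`.
    have hcomp : ∀ a : B, star U * (U * a * star U) * U = p * a * p := by
      intro a
      rw [← hU]; simp only [mul_assoc]
    have h1 := congrArg (fun a => star U * a * U) h
    simp only [hcomp, hpp] at h1
    rwa [hle, mul_assoc, show star v * p = star v by rw [← hpv, star_mul, hps, mul_assoc, hpp]]
      at h1

/-- A Cuntz comparison: if an infinite projection is close to `z x t`, then the hereditary
subalgebra of the self-adjoint element `x` contains an infinite projection. -/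
theorem exists_infiniteProjection_mem_hereditary {p x z t : B} (hp : InfiniteProjection p)
    (hx : star x = x) (h : ‖z * x * t - p‖ < 1) :
    ∃ q ∈ hereditary x, InfiniteProjection q := by
  have hpp : p * p = p := hp.1.isIdempotentElem
  have hps : star p = p := hp.1.isSelfAdjoint
  have hpn : ‖p‖ ≤ 1 := by
    have h1 : ‖p‖ * ‖p‖ = ‖p‖ := by rw [← norm_star_mul_self, hps, hpp]
    nlinarith [norm_nonneg p]
  have h1 : ‖z * (x * t * p) - p‖ < 1 := by
    have : z * (x * t * p) - p = (z * x * t - p) * p := by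
      rw [sub_mul, hpp]; simp only [mul_assoc]
    rw [this]
    refine (norm_mul_le _ _).trans_lt ((mul_le_of_le_one_right (norm_nonneg _) hpn).trans_lt h)
  obtain ⟨c, hpc, hcp, hc⟩ := exists_partialIsometry hp.1 (by rw [mul_assoc, hpp]) h1
  -- With `U = x t p c`, the projection `U U*` is `x (t p c c* p t*) x`.
  refine ⟨_, subset_closure ⟨t * p * c * star c * star p * star t, ?_⟩,
    hp.mul_star hc (by rw [mul_assoc, hcp])⟩
  simp only [star_mul, hx, mul_assoc]

end RealCStarAlgebra

/-! ### Finite rank approximation of compact operators. -/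

open InnerProductSpace in
/-- On a real Hilbert space, compact operators are norm limits of operators of finite rank. -/
theorem IsCompactOperator.mem_closure_span_rankOne {H : Type v} [NormedAddCommGroup H]
    [InnerProductSpace ℝ H] [CompleteSpace H] {k : H →L[ℝ] H} (hk : IsCompactOperator k) :
    k ∈ closure (Submodule.span ℝ
      (Set.range fun q : H × H => rankOne ℝ q.1 q.2) : Set (H →L[ℝ] H)) := by
  rw [Metric.mem_closure_iff]
  intro ε hε
  have htb := (hk.isCompact_closure_image_closedBall 1).totallyBounded
  obtain ⟨F, hF, hcov⟩ := Metric.totallyBounded_iff.1 htb (ε / 2) (half_pos hε)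
  have := hF.to_subtype
  let U : Submodule ℝ H := Submodule.span ℝ F
  have : FiniteDimensional ℝ U := FiniteDimensional.span_of_finite ℝ hF
  -- `U` is spanned by a finite `ε/2`-net of the image of the unit ball. Projecting `k x` onto `U`
  -- moves it no farther than its nearest net point.
  refine ⟨U.starProjection ∘L k, ?_, ?_⟩
  · rw [(stdOrthonormalBasis ℝ U).starProjection_eq_sum_rankOne, ContinuousLinearMap.finsetSum_comp]
    refine Submodule.sum_mem _ fun i _ => ?_
    rw [rankOne_comp]
    exact Submodule.subset_span ⟨(_, _), rfl⟩
  · rw [dist_eq_norm]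
    refine lt_of_le_of_lt ?_ (half_lt_self hε)
    refine ContinuousLinearMap.opNorm_le_of_unit_norm (half_pos hε).le fun x hx => ?_
    have hmem : k x ∈ closure (k '' Metric.closedBall 0 1) :=
      subset_closure ⟨x, by simp [hx], rfl⟩
    obtain ⟨f, hf, hxf⟩ := Set.mem_iUnion₂.1 (hcov hmem)
    have hfU : f ∈ U := Submodule.subset_span hf
    calc ‖k x - U.starProjection (k x)‖ ≤ ‖k x - f‖ := by
          rw [Submodule.starProjection_minimal]
          exact ciInf_le ⟨0, by rintro _ ⟨y, rfl⟩; positivity⟩ (⟨f, hfU⟩ : U)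
      _ ≤ ε / 2 := by rw [← dist_eq_norm]; exact (Metric.mem_ball.1 hxf).le

/-! ### Creation operators and slices on the Hilbert space tensor product. -/

namespace HilbertTensor

variable {H : Type v} {E : Type w} [NormedAddCommGroup H] [InnerProductSpace ℝ H]
  [NormedAddCommGroup E] [InnerProductSpace ℝ E]

/-- The operator `e ↦ ξ ⊗ e`. -/
noncomputable def creation (ξ : H) : E →L[ℝ] HilbertTensor H E :=
  (ofTensor : H ⊗[ℝ] E →ₗᵢ[ℝ] HilbertTensor H E).toContinuousLinearMap ∘L
    TensorProduct.mkL ℝ H E ξ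

theorem creation_apply (ξ : H) (e : E) : creation ξ e = ofTensor (ξ ⊗ₜ[ℝ] e) := rfl

theorem inner_ofTensor_tmul (ξ ζ : H) (e f : E) :
    inner ℝ (ofTensor (ξ ⊗ₜ[ℝ] e)) (ofTensor (ζ ⊗ₜ[ℝ] f)) = inner ℝ ξ ζ * inner ℝ e f := by
  rw [LinearIsometry.inner_map_map, TensorProduct.inner_tmul]

theorem norm_creation_apply (ξ : H) (e : E) : ‖creation ξ e‖ = ‖ξ‖ * ‖e‖ := by
  rw [creation_apply, LinearIsometry.norm_map, TensorProduct.norm_tmul]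

theorem norm_creation_le (ξ : H) : ‖(creation ξ : E →L[ℝ] HilbertTensor H E)‖ ≤ ‖ξ‖ :=
  ContinuousLinearMap.opNorm_le_bound _ (norm_nonneg _) fun e => (norm_creation_apply ξ e).le

theorem creation_smul (c : ℝ) (ξ : H) :
    (creation (c • ξ) : E →L[ℝ] HilbertTensor H E) = c • creation ξ := by
  ext e
  simp [creation_apply, ← TensorProduct.smul_tmul']

/-- Bounded operators out of the Hilbert space tensor product are determined by their values on
elementary tensors. -/
theorem continuousLinearMap_ext {F : Type*} [NormedAddCommGroup F] [NormedSpace ℝ F]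
    {S T : HilbertTensor H E →L[ℝ] F}
    (h : ∀ (ξ : H) (e : E), S (ofTensor (ξ ⊗ₜ[ℝ] e)) = T (ofTensor (ξ ⊗ₜ[ℝ] e))) : S = T := by
  have h1 : (S : HilbertTensor H E → F) = T := by
    refine denseRange_ofTensor.equalizer S.continuous T.continuous (funext fun x => ?_)
    induction x with
    | zero => simp
    | tmul ξ e => exact h ξ e
    | add x y hx hy =>
      simp only [Function.comp_apply, map_add] at hx hy ⊢
      rw [hx, hy]
  exact ContinuousLinearMap.coeFn_injective h1

theorem norm_tensorOp_le (k : H →L[ℝ] H) (T : E →L[ℝ] E) : ‖tensorOp k T‖ ≤ ‖k‖ * ‖T‖ := by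
  refine ContinuousLinearMap.opNorm_le_bound _ (by positivity) fun x => ?_
  refine denseRange_ofTensor.induction_on
    (p := fun x : HilbertTensor H E => ‖tensorOp k T x‖ ≤ ‖k‖ * ‖T‖ * ‖x‖) x
    (isClosed_le (by fun_prop) (by fun_prop)) fun y => ?_
  have h : tensorOp k T (ofTensor y) = ofTensor (TensorProduct.mapL k T y) :=
    ContinuousLinearMap.completion_apply_coe _ _
  rw [h, LinearIsometry.norm_map, LinearIsometry.norm_map]
  exact ((TensorProduct.mapL k T).le_opNorm y).trans
    (mul_le_mul_of_nonneg_right (TensorProduct.norm_mapL_le k T) (norm_nonneg y))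

/-- The map `k ↦ k ⊗ T`. -/
noncomputable def tensorOpLeft (T : E →L[ℝ] E) :
    (H →L[ℝ] H) →L[ℝ] (HilbertTensor H E →L[ℝ] HilbertTensor H E) :=
  LinearMap.mkContinuous
    { toFun := fun k => tensorOp k T
      map_add' := fun k l => continuousLinearMap_ext fun ξ e => by
        simp [tensorOp_tmul, TensorProduct.add_tmul]
      map_smul' := fun c k => continuousLinearMap_ext fun ξ e => by
        simp [tensorOp_tmul, ← TensorProduct.smul_tmul'] }
    ‖T‖ fun k => (norm_tensorOp_le k T).trans_eq (mul_comm _ _)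

variable [CompleteSpace E]

open ContinuousLinearMap

theorem adjoint_creation_tmul (ζ ξ : H) (e : E) :
    adjoint (creation ζ) (ofTensor (ξ ⊗ₜ[ℝ] e)) = (inner ℝ ζ ξ : ℝ) • e := by
  refine ext_inner_left ℝ fun f => ?_
  rw [adjoint_inner_right, creation_apply, inner_ofTensor_tmul, inner_smul_right]

theorem adjoint_creation_creation (ζ ξ : H) (e : E) :
    adjoint (creation ζ) (creation ξ e) = (inner ℝ ζ ξ : ℝ) • e := by
  rw [creation_apply, adjoint_creation_tmul]

theorem tensorOp_rankOne (ξ ζ : H) (T : E →L[ℝ] E) :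
    tensorOp (InnerProductSpace.rankOne ℝ ξ ζ) T = creation ξ ∘L T ∘L adjoint (creation ζ) := by
  refine continuousLinearMap_ext fun η e => ?_
  simp [tensorOp_tmul, adjoint_creation_tmul, creation_apply, ← TensorProduct.smul_tmul']

/-- A nonzero operator on the Hilbert space tensor product has a nonzero slice. -/
theorem exists_slice_ne_zero {S : HilbertTensor H E →L[ℝ] HilbertTensor H E} (hS : S ≠ 0) :
    ∃ ζ ξ : H, ‖ζ‖ = 1 ∧ ‖ξ‖ = 1 ∧ adjoint (creation ζ) ∘L S ∘L creation ξ ≠ (0 : E →L[ℝ] E) := by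
  by_contra! h
  have h1 : ∀ ζ ξ : H, adjoint (creation ζ) ∘L S ∘L creation ξ = (0 : E →L[ℝ] E) := by
    intro ζ ξ
    by_cases hζ : ζ = 0
    · have : (creation ζ : E →L[ℝ] HilbertTensor H E) = 0 := by
        rw [hζ, ← zero_smul ℝ (0 : H), creation_smul, zero_smul]
      rw [this]; simp
    by_cases hξ : ξ = 0
    · have : (creation ξ : E →L[ℝ] HilbertTensor H E) = 0 := by
        rw [hξ, ← zero_smul ℝ (0 : H), creation_smul, zero_smul]
      rw [this]; simp
    have h2 := h (‖ζ‖⁻¹ • ζ) (‖ξ‖⁻¹ • ξ) (norm_smul_inv_norm (𝕜 := ℝ) hζ)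
      (norm_smul_inv_norm (𝕜 := ℝ) hξ)
    rw [creation_smul, creation_smul, map_smulₛₗ, comp_smul, comp_smul, smul_comp] at h2
    simpa [hζ, hξ] using h2
  apply hS
  refine continuousLinearMap_ext fun ξ e => ?_
  rw [zero_apply, ← inner_self_eq_zero (𝕜 := ℝ)]
  -- Vanishing slices make `S (ξ ⊗ e)` orthogonal to every elementary tensor, hence to everything.
  have h3 : (innerSL ℝ (S (ofTensor (ξ ⊗ₜ[ℝ] e))) : HilbertTensor H E →L[ℝ] ℝ) = 0 := by
    refine continuousLinearMap_ext fun ζ f => ?_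
    have h4 : inner ℝ (adjoint (creation ζ) (S (creation ξ e))) f = 0 := by
      have := congrArg (fun T : E →L[ℝ] E => T e) (h1 ζ ξ)
      simp only [comp_apply, zero_apply] at this
      rw [this, inner_zero_left]
    rwa [adjoint_inner_left] at h4
  exact congrArg (fun T : HilbertTensor H E →L[ℝ] ℝ => T (S (ofTensor (ξ ⊗ₜ[ℝ] e)))) h3

end HilbertTensor

/-! ### Rank one tensors and slices in `K(H) ⊗ A`. -/

namespace RealCStarAlgebra

open HilbertTensor ContinuousLinearMap

variable {H : Type v} [NormedAddCommGroup H] [InnerProductSpace ℝ H]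
  {E : Type w} [NormedAddCommGroup E] [InnerProductSpace ℝ E] [CompleteSpace E]
  {A : Type u} [RealCStarAlgebra A] (π : A →⋆ₙₐ[ℝ] (E →L[ℝ] E))

/-- The operators `θ ⊗ π a` for rank one operators `θ`. -/
def rankOneTensors (H : Type v) [NormedAddCommGroup H] [InnerProductSpace ℝ H] :
    Set (HilbertTensor H E →L[ℝ] HilbertTensor H E) :=
  {S | ∃ (α β : H) (a : A), S = creation α ∘L π a ∘L adjoint (creation β)}

theorem creation_comp_mul (α β γ δ : H) (S T : E →L[ℝ] E) :
    (creation α ∘L S ∘L adjoint (creation β)) * (creation γ ∘L T ∘L adjoint (creation δ)) =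
      (inner ℝ β γ : ℝ) • (creation α ∘L (S * T) ∘L adjoint (creation δ)) := by
  ext x
  simp [adjoint_creation_creation]

theorem star_creation_comp (α β : H) (S : E →L[ℝ] E) :
    star (creation α ∘L S ∘L adjoint (creation β)) =
      creation β ∘L star S ∘L adjoint (creation α) := by
  simp only [star_eq_adjoint, adjoint_comp, adjoint_adjoint, comp_assoc]

theorem creation_comp_mem_compactTensor (α β : H) (a : A) :
    creation α ∘L π a ∘L adjoint (creation β) ∈ compactTensor H π := by
  rw [← tensorOp_rankOne]
  refine NonUnitalStarSubalgebra.le_topologicalClosure _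
    (NonUnitalStarAlgebra.subset_adjoin ℝ _ ⟨_, a, ?_, rfl⟩)
  have h2 := (isCompactOperator_of_locallyCompactSpace_rng (M₂ := ℝ) (M₃ := H)
    (ContinuousLinearMap.toSpanSingleton ℝ α)).comp_clm (innerSL ℝ β)
  have h3 : ⇑(InnerProductSpace.rankOne ℝ α β) =
      ContinuousLinearMap.toSpanSingleton ℝ α ∘ innerSL ℝ β := by
    ext x; simp
  rwa [h3]

/-- The set of rank one tensors is already closed under star and products: the scalar `⟪β, γ⟫` is
absorbed into the entry from `A`. -/
theorem toSubmodule_adjoin_rankOneTensors :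
    (NonUnitalStarAlgebra.adjoin ℝ (rankOneTensors π H)).toSubmodule =
      Submodule.span ℝ (rankOneTensors π H) := by
  have hstar : star (rankOneTensors π H) ⊆ rankOneTensors π H := by
    rintro S ⟨α, β, a, h⟩
    exact ⟨β, α, star a, by rw [← star_star S, h, star_creation_comp, map_star]⟩
  let G : Subsemigroup (HilbertTensor H E →L[ℝ] HilbertTensor H E) :=
    { carrier := rankOneTensors π H
      mul_mem' := by
        rintro _ _ ⟨α, β, a, rfl⟩ ⟨γ, δ, b, rfl⟩
        refine ⟨α, δ, (inner ℝ β γ : ℝ) • (a * b), ?_⟩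
        rw [creation_comp_mul, map_smul, map_mul, smul_comp, comp_smul] }
  have hG : (Subsemigroup.closure (rankOneTensors π H) : Set _) = rankOneTensors π H :=
    congrArg SetLike.coe (Subsemigroup.closure_eq G)
  rw [NonUnitalStarAlgebra.adjoin_eq_span, Set.union_eq_self_of_subset_right hstar, hG]

theorem coe_compactTensor_subset [CompleteSpace H] :
    (compactTensor H π : Set (HilbertTensor H E →L[ℝ] HilbertTensor H E)) ⊆
      closure (Submodule.span ℝ (rankOneTensors π H)) := by
  have h : compactTensor H π ≤
      (NonUnitalStarAlgebra.adjoin ℝ (rankOneTensors π H)).topologicalClosure := by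
    refine NonUnitalStarSubalgebra.topologicalClosure_minimal _
      (NonUnitalStarAlgebra.adjoin_le ?_)
      (NonUnitalStarSubalgebra.isClosed_topologicalClosure _)
    rintro _ ⟨k, a, hk, rfl⟩
    have h1 : tensorOpLeft (π a) k ∈ closure (tensorOpLeft (π a) ''
        (Submodule.span ℝ (Set.range fun q : H × H => InnerProductSpace.rankOne ℝ q.1 q.2))) :=
      image_closure_subset_closure_image (tensorOpLeft (π a)).continuous
        ⟨k, hk.mem_closure_span_rankOne, rfl⟩
    refine closure_mono ?_ h1
    rintro _ ⟨l, hl, rfl⟩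
    change _ ∈ (NonUnitalStarAlgebra.adjoin ℝ (rankOneTensors π H)).toSubmodule
    have h2 : Submodule.span ℝ (Set.range fun q : H × H => InnerProductSpace.rankOne ℝ q.1 q.2) ≤
        ((NonUnitalStarAlgebra.adjoin ℝ (rankOneTensors π H)).toSubmodule).comap
          (tensorOpLeft (π a)).toLinearMap := by
      rw [Submodule.span_le]
      rintro _ ⟨q, rfl⟩
      exact NonUnitalStarAlgebra.subset_adjoin ℝ _ ⟨q.1, q.2, a, tensorOp_rankOne _ _ _⟩
    exact h2 hl
  intro S hS
  have h3 : S ∈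
      closure ((NonUnitalStarAlgebra.adjoin ℝ (rankOneTensors π H)).toSubmodule : Set _) := h hS
  rwa [toSubmodule_adjoin_rankOneTensors] at h3

variable {π}

/-- The slices of an element of `K(H) ⊗ A` belong to `A`. -/
theorem exists_slice [CompleteSpace H] (hπ : Isometry π)
    {S : HilbertTensor H E →L[ℝ] HilbertTensor H E}
    (hS : S ∈ compactTensor H π) (ζ ξ : H) :
    ∃ s : A, adjoint (creation ζ) ∘L S ∘L creation ξ = π s := by
  -- The range of the isometry `π` is closed, so the property passes from the span to its closure.
  have hcl : IsClosed {T : HilbertTensor H E →L[ℝ] HilbertTensor H E |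
      adjoint (creation ζ) ∘L T ∘L creation ξ ∈ Set.range π} :=
    hπ.isClosedEmbedding.isClosed_range.preimage
      (continuous_const.clm_comp (continuous_id.clm_comp continuous_const))
  have h : ∀ T ∈ Submodule.span ℝ (rankOneTensors π H),
      ∃ s : A, adjoint (creation ζ) ∘L T ∘L creation ξ = π s := by
    intro T hT
    induction hT using Submodule.span_induction with
    | mem T hT =>
      obtain ⟨α, β, a, rfl⟩ := hT
      refine ⟨((inner ℝ ζ α : ℝ) * (inner ℝ β ξ : ℝ)) • a, ?_⟩
      ext e
      simp [adjoint_creation_creation, smul_smul, mul_comm]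
    | zero => exact ⟨0, by simp⟩
    | add T U _ _ hT hU =>
      obtain ⟨s, hs⟩ := hT
      obtain ⟨t, ht⟩ := hU
      exact ⟨s + t, by rw [map_add, ← hs, ← ht, add_comp, comp_add]⟩
    | smul c T _ hT =>
      obtain ⟨s, hs⟩ := hT
      exact ⟨c • s, by rw [map_smul, ← hs, smul_comp, comp_smul]⟩
  obtain ⟨s, hs⟩ := closure_minimal (fun T hT => (h T hT).imp fun s hs => hs.symm) hcl
    (coe_compactTensor_subset π hS)
  exact ⟨s, hs.symm⟩

variable (π) in
/-- The map `a ↦ θ ⊗ a` from `A` to `K(H) ⊗ A`, where `θ` is the rank one operator given by the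
vectors `α` and `β`. -/
noncomputable def rankOneTensor (α β : H) : A →ₗ[ℝ] compactTensor H π where
  toFun a := ⟨creation α ∘L π a ∘L adjoint (creation β), creation_comp_mem_compactTensor π α β a⟩
  map_add' a b := Subtype.ext <| by simp
  map_smul' c a := Subtype.ext <| by simp

theorem coe_rankOneTensor (α β : H) (a : A) :
    (rankOneTensor π α β a : HilbertTensor H E →L[ℝ] HilbertTensor H E) =
      creation α ∘L π a ∘L adjoint (creation β) := rfl

theorem rankOneTensor_mul (α β γ δ : H) (a b : A) :
    rankOneTensor π α β a * rankOneTensor π γ δ b =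
      (inner ℝ β γ : ℝ) • rankOneTensor π α δ (a * b) :=
  Subtype.ext <| by
    change _ * _ = _ • (_ : HilbertTensor H E →L[ℝ] HilbertTensor H E)
    rw [coe_rankOneTensor, coe_rankOneTensor, creation_comp_mul, coe_rankOneTensor, map_mul]

theorem star_rankOneTensor (α β : H) (a : A) :
    star (rankOneTensor π α β a) = rankOneTensor π β α (star a) :=
  Subtype.ext <| by
    change star (rankOneTensor π α β a : HilbertTensor H E →L[ℝ] HilbertTensor H E) = _
    rw [coe_rankOneTensor, coe_rankOneTensor, star_creation_comp, map_star]

theorem norm_rankOneTensor_le (hπ : Isometry π) (α β : H) (a : A) :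
    ‖rankOneTensor π α β a‖ ≤ ‖α‖ * ‖β‖ * ‖a‖ := by
  change ‖creation α ∘L π a ∘L adjoint (creation β)‖ ≤ _
  have h1 : ‖adjoint (creation β : E →L[ℝ] HilbertTensor H E)‖ ≤ ‖β‖ := by
    rw [LinearIsometryEquiv.norm_map]; exact norm_creation_le β
  have h2 : ‖π a‖ = ‖a‖ := (AddMonoidHomClass.isometry_iff_norm π).1 hπ a
  calc _ ≤ ‖(creation α : E →L[ℝ] HilbertTensor H E)‖ *
        (‖π a‖ * ‖adjoint (creation β : E →L[ℝ] HilbertTensor H E)‖) :=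
      (opNorm_comp_le _ _).trans (mul_le_mul_of_nonneg_left (opNorm_comp_le _ _) (norm_nonneg _))
    _ ≤ ‖α‖ * (‖a‖ * ‖β‖) := by
      rw [h2]
      gcongr
      exact norm_creation_le α
    _ = _ := by ring

theorem continuous_rankOneTensor (hπ : Isometry π) (α β : H) :
    Continuous (rankOneTensor π α β) :=
  (LinearMap.mkContinuous _ _ (norm_rankOneTensor_le hπ α β)).continuous

theorem rankOneTensor_injective (hπ : Isometry π) {α β : H} (hα : ‖α‖ = 1) (hβ : ‖β‖ = 1) :
    Function.Injective (rankOneTensor π α β) := by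
  intro a b h
  apply hπ.injective
  have h1 : ∀ c : A, adjoint (creation α) ∘L
      (rankOneTensor π α β c : HilbertTensor H E →L[ℝ] HilbertTensor H E) ∘L creation β = π c := by
    intro c
    ext e
    simp [coe_rankOneTensor, adjoint_creation_creation, hα, hβ]
  rw [← h1 a, h, h1 b]

/-- The outer factors contribute `adjoint (creation ζ)` and `creation ξ` around `S`, which is
exactly the slice `s`. -/
theorem exists_slice_mul [CompleteSpace H] (hπ : Isometry π) {S : compactTensor H π} (hS : S ≠ 0) :
    ∃ (ζ ξ : H) (s : A), ‖ζ‖ = 1 ∧ ‖ξ‖ = 1 ∧ s ≠ 0 ∧ ∀ (α β : H) (a b : A),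
      rankOneTensor π α ζ a * S * rankOneTensor π ξ β b = rankOneTensor π α β (a * s * b) := by
  obtain ⟨ζ, ξ, hζ, hξ, h⟩ := exists_slice_ne_zero
    (S := (S : HilbertTensor H E →L[ℝ] HilbertTensor H E)) (by simpa using hS)
  obtain ⟨s, hs⟩ := exists_slice hπ S.2 ζ ξ
  refine ⟨ζ, ξ, s, hζ, hξ, ?_, fun α β a b => Subtype.ext ?_⟩
  · rintro rfl
    exact h (by rw [hs, map_zero])
  · change (rankOneTensor π α ζ a : HilbertTensor H E →L[ℝ] HilbertTensor H E) * S *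
      rankOneTensor π ξ β b = _
    simp only [coe_rankOneTensor, map_mul, ← hs]
    rfl

theorem eq_top_of_rankOneTensor_mem [CompleteSpace H] {I : Submodule ℝ (compactTensor H π)}
    (hI : IsClosed (I : Set (compactTensor H π)))
    (h : ∀ (α β : H) (a : A), rankOneTensor π α β a ∈ I) : I = ⊤ := by
  rw [eq_top_iff]
  rintro S -
  have h1 : Submodule.span ℝ (rankOneTensors π H) ≤
      I.map (compactTensor H π).toSubmodule.subtype := by
    rw [Submodule.span_le]
    rintro _ ⟨α, β, a, rfl⟩
    exact ⟨_, h α β a, rfl⟩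
  have h2 : (S : HilbertTensor H E →L[ℝ] HilbertTensor H E) ∈
      Subtype.val '' (I : Set (compactTensor H π)) := by
    have hcl : IsClosed (Subtype.val '' (I : Set (compactTensor H π))) :=
      (isClosed_compactTensor H π).isClosedEmbedding_subtypeVal.isClosedMap _ hI
    exact closure_minimal (fun T hT => h1 hT) hcl (coe_compactTensor_subset π S.2)
  obtain ⟨T, hT, hTS⟩ := h2
  rwa [← Subtype.ext hTS]

/-! ### Simplicity of the tensor product. -/

theorem compactTensor_simple [CompleteSpace H] [Nontrivial H] (hA : Simple A) (hπ : Isometry π) :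
    Simple (compactTensor H π) := by
  obtain ⟨hnt, hA⟩ := hA
  obtain ⟨η, hη⟩ := exists_norm_eq H zero_le_one
  refine ⟨(rankOneTensor_injective hπ hη hη).nontrivial, fun I hI hideal => ?_⟩
  refine or_iff_not_imp_left.2 fun hbot => eq_top_of_rankOneTensor_mem hI fun α β a => ?_
  obtain ⟨S, hSI, hS⟩ := Submodule.exists_mem_ne_zero_of_ne_bot hbot
  obtain ⟨ζ, ξ, s, hζ, hξ, hs, hslice⟩ := exists_slice_mul hπ hS
  -- Requiring all positions at once makes `J` an ideal: the unit vector `η` serves as the inner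
  -- index when multiplying by an element of `A`.
  let J : Submodule ℝ A := ⨅ q : H × H, I.comap (rankOneTensor π q.1 q.2)
  have hJ : ∀ a, a ∈ J ↔ ∀ α β, rankOneTensor π α β a ∈ I := by
    intro a
    simp only [J, Submodule.mem_iInf, Submodule.mem_comap, Prod.forall]
  have hJc : IsClosed (J : Set A) := by
    simp only [J, Submodule.coe_iInf]
    exact isClosed_iInter fun q => hI.preimage (continuous_rankOneTensor hπ q.1 q.2)
  have hJi : ∀ a : A, ∀ x ∈ J, a * x ∈ J ∧ x * a ∈ J := by
    intro a x hx
    rw [hJ] at hx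
    constructor
    · rw [hJ]
      intro α β
      have := (hideal (rankOneTensor π α η a) _ (hx η β)).1
      rwa [rankOneTensor_mul, real_inner_self_eq_norm_sq, hη, one_pow, one_smul] at this
    · rw [hJ]
      intro α β
      have := (hideal (rankOneTensor π η β a) _ (hx α η)).2
      rwa [rankOneTensor_mul, real_inner_self_eq_norm_sq, hη, one_pow, one_smul] at this
  -- `A` may lack a unit, so `s` is flanked by `star s` on both sides; the C*-identity keeps the
  -- product nonzero.
  have hmem : star s * s * star s ∈ J := by
    rw [hJ]
    intro α β
    rw [← hslice]
    exact (hideal _ _ (hideal _ _ hSI).1).2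
  have hne : star s * s * star s ≠ 0 := by
    intro h
    have h1 : star s * s * star (star s * s) = 0 := by
      rw [star_mul, star_star, ← mul_assoc, h, zero_mul]
    exact hs ((CStarRing.star_mul_self_eq_zero_iff s).1
      ((CStarRing.mul_star_self_eq_zero_iff (star s * s)).1 h1))
  rcases hA J hJc hJi with h | h
  · rw [h] at hmem
    exact absurd ((Submodule.mem_bot ℝ).1 hmem) hne
  · exact (hJ a).1 (by rw [h]; trivial) α β

/-! ### Pure infiniteness of the tensor product. -/

theorem InfiniteProjection.rankOneTensor (hπ : Isometry π) {ξ : H} (hξ : ‖ξ‖ = 1) {p : A}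
    (hp : InfiniteProjection p) : InfiniteProjection (rankOneTensor π ξ ξ p) := by
  have hmul : ∀ a b : A, RealCStarAlgebra.rankOneTensor π ξ ξ a *
      RealCStarAlgebra.rankOneTensor π ξ ξ b = RealCStarAlgebra.rankOneTensor π ξ ξ (a * b) := by
    intro a b
    rw [rankOneTensor_mul, real_inner_self_eq_norm_sq, hξ, one_pow, one_smul]
  have hproj : ∀ q : A, IsStarProjection q →
      IsStarProjection (RealCStarAlgebra.rankOneTensor π ξ ξ q) := by
    rintro q ⟨h1, h2⟩
    refine ⟨?_, ?_⟩
    · exact (hmul q q).trans (congrArg _ h1)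
    · exact (star_rankOneTensor ξ ξ q).trans (congrArg _ h2)
  obtain ⟨hp, v, hv, hvv, hle, hne⟩ := hp
  refine ⟨hproj p hp, RealCStarAlgebra.rankOneTensor π ξ ξ v, ?_, ?_, ?_, ?_⟩
  · rw [star_rankOneTensor, hmul, hv]
  · rw [star_rankOneTensor, hmul]; exact hproj _ hvv
  · rw [star_rankOneTensor, hmul, hmul, hle]
  · rw [star_rankOneTensor, hmul]
    exact fun h => hne (rankOneTensor_injective hπ hξ hξ h)

theorem compactTensor_purelyInfinite [CompleteSpace H] (hA : PurelyInfinite A) (hπ : Isometry π) :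
    PurelyInfinite (compactTensor H π) := by
  rintro x ⟨y, hy⟩ hx
  have hxs : star x = x := by rw [hy, star_mul, star_star]
  obtain ⟨ζ, ξ, s, hζ, hξ, hs, hslice⟩ := exists_slice_mul hπ hx
  obtain ⟨p, hp, hinf⟩ := hA (star s * s) ⟨s, rfl⟩
    (fun h => hs ((CStarRing.star_mul_self_eq_zero_iff s).1 h))
  obtain ⟨_, ⟨b, rfl⟩, hb⟩ := Metric.mem_closure_iff.1 hp 1 one_pos
  -- By the slice formula `z x t` is the rank one tensor with entry `s* s b s* s`, which is within
  -- `1` of `p`; tensoring with unit vectors does not increase the norm.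
  refine exists_infiniteProjection_mem_hereditary (hinf.rankOneTensor hπ hξ) hxs
    (z := rankOneTensor π ξ ζ (star s)) (t := rankOneTensor π ξ ξ (b * (star s * s))) ?_
  rw [hslice, ← map_sub, ← mul_assoc]
  refine (norm_rankOneTensor_le hπ _ _ _).trans_lt ?_
  rwa [hξ, one_mul, one_mul, ← dist_eq_norm, dist_comm]

end RealCStarAlgebra

theorem mainTheorem8 {A : Type u} [RealCStarAlgebra A]
    (hsimple : RealCStarAlgebra.Simple A) (hpi : RealCStarAlgebra.PurelyInfinite A)
    {E : Type w} [NormedAddCommGroup E] [InnerProductSpace ℝ E] [CompleteSpace E]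
    (π : A →⋆ₙₐ[ℝ] (E →L[ℝ] E)) (hπ : Isometry π)
    (H : Type v) [NormedAddCommGroup H] [InnerProductSpace ℝ H] [CompleteSpace H] [Nontrivial H] :
    RealCStarAlgebra.PurelyInfinite (RealCStarAlgebra.compactTensor H π) ∧
      RealCStarAlgebra.Simple (RealCStarAlgebra.compactTensor H π) :=
  ⟨RealCStarAlgebra.compactTensor_purelyInfinite hpi hπ,
    RealCStarAlgebra.compactTensor_simple hsimple hπ⟩
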